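/- Let $B$ be a set of integers greater than $1$ that is primitive, i.e. no element of $B$ divides another element of $B$. Suppose that $B$ is a Behrend set, i.e. the set $\mathcal F_B=\{n\ge 1:\ b\nmid n\text{ for every } b\in B\}$ of $B$-free numbers has logarithmic density zero: $$\lim_{n\to\infty}\frac1{\log n}\sum_{j\in\mathcal F_B,\ j\le n}\frac1j=0$$ (equivalently, $\mathcal F_B$ has natural density zero). Then the upper Banach density of $B$ is zero: $$BD^\ast(B):=\limsup_{n\to\infty}\frac1n\max_{m\ge 1}\bigl|B\cap[m,m+n]\bigr|=0.$$ -/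

import Mathlib

open Filter Topology

/-- `B` is primitive: no element of `B` divides another element of `B`. -/
def IsPrimitiveSet (B : Set ℕ) : Prop :=
  ∀ b ∈ B, ∀ c ∈ B, b ∣ c → b = c

/-- The `B`-free numbers: the natural numbers with no divisor in `B`. -/
def freeNumbers (B : Set ℕ) : Set ℕ :=
  {n | ∀ b ∈ B, ¬ b ∣ n}

/-- `A` has logarithmic density `d`: the limit of `(1 / log n) * ∑_{j ∈ A, 1 ≤ j ≤ n} 1 / j`
exists and equals `d`. -/
def HasLogDensity (A : Set ℕ) (d : ℝ) : Prop :=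
  Tendsto (fun n : ℕ =>
    (∑ j ∈ Finset.Icc 1 n, A.indicator (fun i : ℕ => 1 / (i : ℝ)) j) / Real.log n)
    atTop (𝓝 d)

/-- `B` is a Behrend set: the set of `B`-free numbers has logarithmic density zero. -/
def IsBehrend (B : Set ℕ) : Prop :=
  HasLogDensity (freeNumbers B) 0

/-- The largest number of elements of `A` in an interval `[m, m + n]` with `m ≥ 1`. -/
noncomputable def maxWindowCount (A : Set ℕ) (n : ℕ) : ℕ :=
  ⨆ m : {m : ℕ // 1 ≤ m}, (A ∩ Set.Icc (m : ℕ) (m + n)).ncard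

/-- The upper Banach density of `A`. -/
noncomputable def upperBanachDensity (A : Set ℕ) : ℝ :=
  limsup (fun n : ℕ => (maxWindowCount A n : ℝ) / n) atTop

theorem windowCount_le (A : Set ℕ) (m n : ℕ) :
    (A ∩ Set.Icc m (m + n)).ncard ≤ n + 1 := by
  refine (Set.ncard_le_ncard Set.inter_subset_right (Set.finite_Icc _ _)).trans ?_
  rw [← Finset.coe_Icc, Set.ncard_coe_finset, Nat.card_Icc]
  omega

/-- The supremum in `maxWindowCount` is over a bounded set, so it is a maximum. -/
theorem bddAbove_windowCount (A : Set ℕ) (n : ℕ) :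
    BddAbove (Set.range fun m : {m : ℕ // 1 ≤ m} =>
      (A ∩ Set.Icc (m : ℕ) (m + n)).ncard) :=
  ⟨n + 1, by rintro _ ⟨m, rfl⟩; exact windowCount_le A m n⟩

theorem maxWindowCount_le (A : Set ℕ) (n : ℕ) : maxWindowCount A n ≤ n + 1 :=
  haveI : Nonempty {m : ℕ // 1 ≤ m} := ⟨⟨1, le_rfl⟩⟩
  ciSup_le fun m => windowCount_le A m n

theorem maxWindowCount_div_le_two (A : Set ℕ) (n : ℕ) :
    (maxWindowCount A n : ℝ) / n ≤ 2 := by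
  rcases Nat.eq_zero_or_pos n with rfl | hn
  · simp
  · have h1 : (1 : ℝ) ≤ n := by exact_mod_cast hn
    have h2 : (maxWindowCount A n : ℝ) ≤ n + 1 := by exact_mod_cast maxWindowCount_le A n
    rw [div_le_iff₀ (by linarith)]
    linarith

/-- The upper limit in `upperBanachDensity` is that of a bounded sequence. -/
theorem isBoundedUnder_maxWindowCount_div (A : Set ℕ) :
    IsBoundedUnder (· ≤ ·) atTop (fun n : ℕ => (maxWindowCount A n : ℝ) / n) ∧
      IsBoundedUnder (· ≥ ·) atTop (fun n : ℕ => (maxWindowCount A n : ℝ) / n) :=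
  ⟨isBoundedUnder_of ⟨2, maxWindowCount_div_le_two A⟩,
    isBoundedUnder_of ⟨0, fun n => by positivity⟩⟩

/-! By primitivity an element of `B` above `K` is free of `B ∩ [1, K]`. Those free numbers are
periodic modulo `K!`, so the upper Banach density of `B` is at most their density, and this must be
made small by choice of `K` (a Davenport–Erdős type statement).

Compare sets with weights `n ^ (-s)`, `s > 1`. Logarithmic density zero makes the `B`-free numbers
relatively negligible at some `s`; fixing it, a large `K` makes the truncated free numbers
negligible too, since they exceed the `B`-free numbers only above `K`. The relative weight of a
divisor-closed set does not increase as `s` decreases (`dirichletSum_mul_le_of_dvd_closed`), so the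
bound persists as the exponent tends to `1`, where it controls the natural density of a periodic set
(`count_freeNumbers_le`). -/

open scoped ENNReal

/-! ### Convolution identities for power weights -/

/-- The power function `n ↦ n ^ (-t)` as an arithmetic function. -/
noncomputable def rpowNegArith (t : ℝ) : ArithmeticFunction ℝ :=
  ⟨fun n => if n = 0 then 0 else (n : ℝ) ^ (-t), by simp⟩

theorem rpowNegArith_apply (t : ℝ) {n : ℕ} (hn : n ≠ 0) :
    rpowNegArith t n = (n : ℝ) ^ (-t) := by
  simp [rpowNegArith, hn]

theorem isMultiplicative_rpowNegArith (t : ℝ) : (rpowNegArith t).IsMultiplicative := by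
  rw [ArithmeticFunction.IsMultiplicative.iff_ne_zero]
  refine ⟨by simp [rpowNegArith], fun {m n} hm hn _ => ?_⟩
  rw [rpowNegArith_apply t (mul_ne_zero hm hn), rpowNegArith_apply t hm,
    rpowNegArith_apply t hn, Nat.cast_mul, Real.mul_rpow (by positivity) (by positivity)]

/-- Both sides are multiplicative; at `p ^ k`, with `q = p ^ (-t)`, the sum of `q ^ i * (1 - q)`
over `i < k` telescopes against the last term `q ^ k` to give `1`. -/
theorem rpowNegArith_mul_prodPrimeFactors (t : ℝ) :
    rpowNegArith t * ArithmeticFunction.prodPrimeFactors (fun p => 1 - (p : ℝ) ^ (-t)) =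
      ((ArithmeticFunction.zeta : ArithmeticFunction ℕ) : ArithmeticFunction ℝ) := by
  have hP := isMultiplicative_rpowNegArith t
  have hQ := ArithmeticFunction.IsMultiplicative.prodPrimeFactors
    (fun p : ℕ => 1 - (p : ℝ) ^ (-t))
  rw [ArithmeticFunction.IsMultiplicative.eq_iff_eq_on_prime_powers _ (hP.mul hQ) _
    ArithmeticFunction.isMultiplicative_zeta.natCast]
  intro p k hp
  have hpk : ∀ i, p ^ i ≠ 0 := fun i => pow_ne_zero _ hp.ne_zero
  have hpow : ∀ i, rpowNegArith t (p ^ i) = ((p : ℝ) ^ (-t)) ^ i := by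
    intro i
    rw [rpowNegArith_apply t (hpk i), Nat.cast_pow, ← Real.rpow_natCast, ← Real.rpow_natCast,
      ← Real.rpow_mul (by positivity), ← Real.rpow_mul (by positivity), mul_comm]
  have hprod : ∀ i, i ≠ 0 → ArithmeticFunction.prodPrimeFactors
      (fun p : ℕ => 1 - (p : ℝ) ^ (-t)) (p ^ i) = 1 - (p : ℝ) ^ (-t) := by
    intro i hi
    rw [ArithmeticFunction.prodPrimeFactors_apply (hpk i), Nat.primeFactors_prime_pow hi hp,
      Finset.prod_singleton]
  rw [ArithmeticFunction.mul_apply, Nat.sum_divisorsAntidiagonal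
    (fun a b => rpowNegArith t a * ArithmeticFunction.prodPrimeFactors
      (fun p : ℕ => 1 - (p : ℝ) ^ (-t)) b), Nat.sum_divisors_prime_pow hp,
    Finset.sum_range_succ, Nat.div_self (Nat.pos_of_ne_zero (hpk k)), hQ.map_one, hpow, mul_one,
    Finset.sum_congr rfl (g := fun i => ((p : ℝ) ^ (-t)) ^ i - ((p : ℝ) ^ (-t)) ^ (i + 1)),
    Finset.sum_range_sub']
  · simp [ArithmeticFunction.zeta_apply, hp.ne_zero]
  · intro i hi
    have hik := Finset.mem_range.1 hi
    rw [Nat.pow_div hik.le hp.pos, hprod _ (by omega), hpow]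
    ring

/-- For `u ≤ s` the function `n ↦ n ^ (-u)` is the Dirichlet convolution of `n ↦ n ^ (-s)` with a
nonnegative function. -/
theorem exists_nonneg_rpow_convolution {u s : ℝ} (hus : u ≤ s) :
    ∃ g : ℕ → ℝ, (∀ n, 0 ≤ g n) ∧ ∀ n : ℕ, n ≠ 0 →
      ∑ x ∈ n.divisorsAntidiagonal, (x.1 : ℝ) ^ (-s) * g x.2 = (n : ℝ) ^ (-u) := by
  set h := ArithmeticFunction.prodPrimeFactors (fun p => 1 - (p : ℝ) ^ (-(s - u))) with hh
  -- Twisting the previous identity, at `t = s - u`, by `n ^ (-u)` yields this witness; `u ≤ s`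
  -- makes each factor of `h` nonnegative.
  refine ⟨fun n => (n : ℝ) ^ (-u) * h n, fun n => mul_nonneg (by positivity) ?_, fun n hn => ?_⟩
  · rcases eq_or_ne n 0 with rfl | hn
    · simp
    rw [hh, ArithmeticFunction.prodPrimeFactors_apply hn]
    refine Finset.prod_nonneg fun p hp => sub_nonneg.2 ?_
    exact Real.rpow_le_one_of_one_le_of_nonpos
      (by exact_mod_cast (Nat.prime_of_mem_primeFactors hp).one_le) (by linarith)
  · have key := congrArg (fun f : ArithmeticFunction ℝ => f n)
      (rpowNegArith_mul_prodPrimeFactors (s - u))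
    simp only [ArithmeticFunction.mul_apply, ArithmeticFunction.natCoe_apply,
      ArithmeticFunction.zeta_apply, hn, if_false, Nat.cast_one] at key
    rw [← mul_one ((n : ℝ) ^ (-u)), ← key, Finset.mul_sum]
    refine Finset.sum_congr rfl fun x hx => ?_
    have hx' := Nat.mem_divisorsAntidiagonal.1 hx
    have h1 : x.1 ≠ 0 := left_ne_zero_of_mul (hx'.1 ▸ hn)
    have h2 : x.2 ≠ 0 := right_ne_zero_of_mul (hx'.1 ▸ hn)
    have h3 : (0 : ℝ) < x.1 := by positivity
    rw [rpowNegArith_apply _ h1, ← hx'.1, Nat.cast_mul, Real.mul_rpow (by positivity)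
      (by positivity), show -s = -u + -(s - u) by ring, Real.rpow_add h3]
    ring

/-! ### Weighted densities of divisor-closed sets -/

/-- The Dirichlet series of the indicator function of `A`, over the positive integers. -/
noncomputable def dirichletSum (A : Set ℕ) (s : ℝ) : ℝ≥0∞ :=
  ∑' n : ℕ+, A.indicator (fun n => ENNReal.ofReal ((n : ℝ) ^ (-s))) n

theorem dirichletSum_mono {A A' : Set ℕ} (h : A ⊆ A') (s : ℝ) :
    dirichletSum A s ≤ dirichletSum A' s :=
  ENNReal.tsum_le_tsum fun _ => Set.indicator_le_indicator_of_subset h (fun _ => zero_le) _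

/-- The density of a divisor-closed set with respect to the weights `n ^ (-s)` is monotone in
`s`. -/
theorem dirichletSum_mul_le_of_dvd_closed {A : Set ℕ} (hA : ∀ m n, m * n ∈ A → m ∈ A) {u s : ℝ}
    (hus : u ≤ s) :
    dirichletSum A u * dirichletSum Set.univ s ≤ dirichletSum A s * dirichletSum Set.univ u := by
  obtain ⟨g, hg0, hg⟩ := exists_nonneg_rpow_convolution hus
  have expand : ∀ A : Set ℕ, dirichletSum A u = ∑' (a : ℕ+) (b : ℕ+),
      A.indicator (fun _ => ENNReal.ofReal ((a : ℝ) ^ (-s)) * ENNReal.ofReal (g b)) (a * b : ℕ) := by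
    intro A
    rw [← ENNReal.tsum_prod (f := fun a b : ℕ+ => A.indicator (fun _ =>
      ENNReal.ofReal ((a : ℝ) ^ (-s)) * ENNReal.ofReal (g b)) (a * b : ℕ)),
      ← sigmaAntidiagonalEquivProd.tsum_eq, ENNReal.tsum_sigma']
    refine tsum_congr fun n => ?_
    have hterm : ∀ x : (n : ℕ).divisorsAntidiagonal, A.indicator (fun _ =>
        ENNReal.ofReal (((sigmaAntidiagonalEquivProd ⟨n, x⟩).1 : ℝ) ^ (-s)) *
          ENNReal.ofReal (g (sigmaAntidiagonalEquivProd ⟨n, x⟩).2))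
        ((sigmaAntidiagonalEquivProd ⟨n, x⟩).1 * (sigmaAntidiagonalEquivProd ⟨n, x⟩).2 : ℕ) =
        A.indicator (fun _ => ENNReal.ofReal ((x.1.1 : ℝ) ^ (-s) * g x.1.2)) (n : ℕ) := by
      intro x
      rw [ENNReal.ofReal_mul (by positivity)]
      congr 1
      exact divisorsAntidiagonalFactors_eq x
    rw [tsum_congr hterm, tsum_fintype]
    by_cases hn : (n : ℕ) ∈ A
    · simp only [Set.indicator_of_mem hn]
      rw [Finset.univ_eq_attach, Finset.sum_attach _ (fun x : ℕ × ℕ =>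
        ENNReal.ofReal ((x.1 : ℝ) ^ (-s) * g x.2)), ← ENNReal.ofReal_sum_of_nonneg
        (fun x _ => mul_nonneg (by positivity) (hg0 _)), hg n n.ne_zero]
    · simp [Set.indicator_of_notMem hn]
  -- Weakening `a * b ∈ A` to `a ∈ A` decouples the double sum; for the full set nothing is lost.
  have hle : ∀ A : Set ℕ, (∀ m n, m * n ∈ A → m ∈ A) → dirichletSum A u ≤ dirichletSum A s *
      ∑' b : ℕ+, ENNReal.ofReal (g b) := by
    intro A hA
    rw [expand, dirichletSum, ← ENNReal.tsum_mul_right]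
    refine ENNReal.tsum_le_tsum fun a => ?_
    rw [← ENNReal.tsum_mul_left]
    refine ENNReal.tsum_le_tsum fun b => ?_
    by_cases hab : (a * b : ℕ) ∈ A
    · rw [Set.indicator_of_mem hab, Set.indicator_of_mem (hA _ _ hab)]
    · rw [Set.indicator_of_notMem hab]
      exact zero_le
  have huniv : dirichletSum Set.univ u = dirichletSum Set.univ s *
      ∑' b : ℕ+, ENNReal.ofReal (g b) := by
    rw [expand, dirichletSum, ← ENNReal.tsum_mul_right]
    simp [ENNReal.tsum_mul_left]
  calc _ ≤ (dirichletSum A s * ∑' b : ℕ+, ENNReal.ofReal (g b)) * dirichletSum Set.univ s := by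
        gcongr; exact hle A hA
    _ = _ := by rw [huniv]; ring

/-! ### From logarithmic density to Dirichlet series -/

theorem dirichletSum_eq_tsum_succ (A : Set ℕ) (s : ℝ) :
    dirichletSum A s =
      ∑' n : ℕ, ENNReal.ofReal (A.indicator (fun n : ℕ => (n : ℝ) ^ (-s)) (n + 1)) := by
  rw [dirichletSum, tsum_pnat_eq_tsum_succ (f := A.indicator
    (fun n : ℕ => ENNReal.ofReal ((n : ℝ) ^ (-s))))]
  refine tsum_congr fun n => ?_
  by_cases hn : n + 1 ∈ A <;> simp [hn]

theorem dirichletSum_ne_top (A : Set ℕ) {s : ℝ} (hs : 1 < s) : dirichletSum A s ≠ ∞ := by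
  refine ne_top_of_le_ne_top ?_ (dirichletSum_mono (Set.subset_univ A) s)
  have h : Summable fun n : ℕ => ((n + 1 : ℕ) : ℝ) ^ (-s) :=
    (summable_nat_add_iff 1).2 (Real.summable_nat_rpow.2 (by linarith))
  rw [dirichletSum_eq_tsum_succ]
  simpa using h.tsum_ofReal_ne_top

theorem one_le_dirichletSum_univ (s : ℝ) : 1 ≤ dirichletSum Set.univ s := by
  refine le_trans ?_ (ENNReal.le_tsum (1 : ℕ+))
  simp

/-- The Dirichlet series of the positive integers is unbounded to the right of `1`. -/
theorem exists_le_dirichletSum_univ (M : ℝ) :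
    ∃ s : ℝ, 1 < s ∧ ENNReal.ofReal M ≤ dirichletSum Set.univ s := by
  obtain ⟨N, hN⟩ := (Real.tendsto_sum_range_one_div_nat_succ_atTop.eventually_gt_atTop M).exists
  have hcont : Tendsto (fun s : ℝ => ∑ i ∈ Finset.range N, ((i + 1 : ℕ) : ℝ) ^ (-s)) (𝓝[>] 1)
      (𝓝 (∑ i ∈ Finset.range N, ((i + 1 : ℕ) : ℝ) ^ (-1 : ℝ))) := by
    refine Tendsto.mono_left (tendsto_finsetSum _ fun i _ => ?_) nhdsWithin_le_nhds
    exact ((Real.continuous_const_rpow (by positivity)).comp continuous_neg).tendsto 1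
  have hlt : M < ∑ i ∈ Finset.range N, ((i + 1 : ℕ) : ℝ) ^ (-1 : ℝ) := by
    simpa [Real.rpow_neg_one] using hN
  obtain ⟨s, hs, hs1⟩ := ((hcont.eventually_const_lt hlt).and self_mem_nhdsWithin).exists
  refine ⟨s, hs1, (ENNReal.ofReal_le_ofReal hs.le).trans ?_⟩
  rw [ENNReal.ofReal_sum_of_nonneg (fun i _ => by positivity), dirichletSum_eq_tsum_succ]
  simpa using ENNReal.sum_le_tsum (f := fun n : ℕ => ENNReal.ofReal (((n + 1 : ℕ) : ℝ) ^ (-s)))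
    (Finset.range N)

/-- Summation by parts: the partial sums of `c` get nonnegative weights totalling `w 0`. -/
theorem sum_mul_le_of_antitone {c w : ℕ → ℝ} {C : ℝ} (hw : Antitone w) (hw0 : ∀ n, 0 ≤ w n)
    (hC : 0 ≤ C) (hc : ∀ n, ∑ i ∈ Finset.range n, c i ≤ C) (n : ℕ) :
    ∑ i ∈ Finset.range n, c i * w i ≤ C * w 0 := by
  have key : ∀ n, ∑ i ∈ Finset.range (n + 1), c i * w i ≤
      (∑ i ∈ Finset.range (n + 1), c i) * w n + C * (w 0 - w n) := by
    intro n
    induction n with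
    | zero => simp
    | succ n ih =>
      rw [Finset.sum_range_succ, Finset.sum_range_succ _ (n + 1)]
      nlinarith [mul_le_mul_of_nonneg_right (hc (n + 1)) (sub_nonneg.2 (hw n.le_succ))]
  cases n with
  | zero => simpa using mul_nonneg hC (hw0 0)
  | succ n => nlinarith [key n, mul_le_mul_of_nonneg_right (hc (n + 1)) (hw0 n)]

/-- A bound for the logarithmic counting function gives a bound for the Dirichlet series. -/
theorem dirichletSum_le_of_forall_sum_le {A : Set ℕ} {ε C : ℝ} (hε : 0 ≤ ε) (hC : 0 ≤ C)
    (h : ∀ n : ℕ, ∑ j ∈ Finset.Icc 1 n, A.indicator (fun i : ℕ => 1 / (i : ℝ)) j ≤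
      ε * ∑ j ∈ Finset.Icc 1 n, 1 / (j : ℝ) + C) {s : ℝ} (hs : 1 < s) :
    dirichletSum A s ≤ ENNReal.ofReal ε * dirichletSum Set.univ s + ENNReal.ofReal C := by
  have shift : ∀ (f : ℕ → ℝ) n, ∑ j ∈ Finset.Icc 1 n, f j = ∑ i ∈ Finset.range n, f (i + 1) := by
    intro f n
    rw [Finset.range_eq_Ico, Finset.sum_Ico_add' f 0 n 1]
    rfl
  rw [dirichletSum_eq_tsum_succ A]
  refine ENNReal.tsum_le_of_sum_range_le fun n => ?_
  have hnn : ∀ i : ℕ, 0 ≤ A.indicator (fun n : ℕ => (n : ℝ) ^ (-s)) (i + 1) := fun i =>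
    Set.indicator_nonneg (fun _ _ => by positivity) _
  have habel := sum_mul_le_of_antitone
    (c := fun i => A.indicator (fun i : ℕ => 1 / (i : ℝ)) (i + 1) - ε * (1 / ((i + 1 : ℕ) : ℝ)))
    (w := fun i => ((i + 1 : ℕ) : ℝ) ^ (-(s - 1))) (C := C)
    (fun i j hij => Real.rpow_le_rpow_of_nonpos (by positivity) (by gcongr) (by linarith))
    (fun i => by positivity) hC
    (fun n => by
      have := h n
      rw [shift, shift] at this
      rw [Finset.sum_sub_distrib, ← Finset.mul_sum]
      linarith) n
  have hterm : ∀ i : ℕ, (A.indicator (fun i : ℕ => 1 / (i : ℝ)) (i + 1) -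
      ε * (1 / ((i + 1 : ℕ) : ℝ))) * ((i + 1 : ℕ) : ℝ) ^ (-(s - 1)) =
      A.indicator (fun n : ℕ => (n : ℝ) ^ (-s)) (i + 1) - ε * ((i + 1 : ℕ) : ℝ) ^ (-s) := by
    intro i
    have hpow : ((i + 1 : ℕ) : ℝ) ^ (-s) =
        1 / ((i + 1 : ℕ) : ℝ) * ((i + 1 : ℕ) : ℝ) ^ (-(s - 1)) := by
      rw [one_div, ← Real.rpow_neg_one, ← Real.rpow_add (by positivity)]
      ring_nf
    by_cases hi : i + 1 ∈ A
    · rw [Set.indicator_of_mem hi, Set.indicator_of_mem hi, hpow]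
      ring
    · rw [Set.indicator_of_notMem hi, Set.indicator_of_notMem hi, hpow]
      ring
  simp only [hterm, Finset.sum_sub_distrib, ← Finset.mul_sum] at habel
  simp only [zero_add, Nat.cast_one, Real.one_rpow, mul_one] at habel
  calc _ = ENNReal.ofReal (∑ i ∈ Finset.range n,
          A.indicator (fun n : ℕ => (n : ℝ) ^ (-s)) (i + 1)) :=
        (ENNReal.ofReal_sum_of_nonneg fun i _ => hnn i).symm
    _ ≤ ENNReal.ofReal (ε * ∑ i ∈ Finset.range n, ((i + 1 : ℕ) : ℝ) ^ (-s) + C) :=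
        ENNReal.ofReal_le_ofReal (by linarith)
    _ = ENNReal.ofReal ε * ∑ i ∈ Finset.range n, ENNReal.ofReal (((i + 1 : ℕ) : ℝ) ^ (-s)) +
          ENNReal.ofReal C := by
        rw [ENNReal.ofReal_add (mul_nonneg hε (Finset.sum_nonneg fun i _ => by positivity)) hC,
          ENNReal.ofReal_mul hε, ENNReal.ofReal_sum_of_nonneg fun i _ => by positivity]
    _ ≤ _ := by
        rw [dirichletSum_eq_tsum_succ Set.univ]
        gcongr
        simpa using ENNReal.sum_le_tsum
          (f := fun n : ℕ => ENNReal.ofReal (((n + 1 : ℕ) : ℝ) ^ (-s))) (Finset.range n)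

/-- A set of logarithmic density zero has relatively small Dirichlet series somewhere to the right
of `1`. -/
theorem HasLogDensity.exists_dirichletSum_le {A : Set ℕ} (hA : HasLogDensity A 0) {ε : ℝ}
    (hε : 0 < ε) :
    ∃ s : ℝ, 1 < s ∧ dirichletSum A s ≤ ENNReal.ofReal (2 * ε) * dirichletSum Set.univ s := by
  obtain ⟨N, hN⟩ := eventually_atTop.1 ((hA.eventually_lt_const hε).and (eventually_ge_atTop 2))
  set S : ℕ → ℝ := fun n => ∑ j ∈ Finset.Icc 1 n, A.indicator (fun i : ℕ => 1 / (i : ℝ)) j with hS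
  have hnn : ∀ j, 0 ≤ A.indicator (fun i : ℕ => 1 / (i : ℝ)) j := fun j =>
    Set.indicator_nonneg (fun _ _ => by positivity) _
  have hS0 : 0 ≤ S N := Finset.sum_nonneg fun j _ => hnn j
  have hH : ∀ n : ℕ, 0 ≤ ∑ j ∈ Finset.Icc 1 n, 1 / (j : ℝ) := fun n =>
    Finset.sum_nonneg fun j _ => by positivity
  have hbound : ∀ n : ℕ, S n ≤ ε * ∑ j ∈ Finset.Icc 1 n, 1 / (j : ℝ) + S N := by
    intro n
    rcases le_total n N with hn | hn
    · have : S n ≤ S N := Finset.sum_le_sum_of_subset_of_nonneg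
        (Finset.Icc_subset_Icc_right hn) fun j _ _ => hnn j
      nlinarith [hH n]
    · obtain ⟨h1, h2⟩ := hN n hn
      have hn1 : (1 : ℝ) < n := by exact_mod_cast h2
      have h3 : S n ≤ ε * Real.log n := ((div_lt_iff₀ (Real.log_pos hn1)).1 h1).le
      have h4 : Real.log n ≤ ∑ j ∈ Finset.Icc 1 n, 1 / (j : ℝ) := by
        refine (Real.log_le_log (by linarith) (by push_cast; linarith)).trans
          ((log_add_one_le_harmonic n).trans_eq ?_)
        rw [harmonic_eq_sum_Icc]
        push_cast
        simp
      nlinarith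
  -- Taking `s` near the pole at `1` absorbs the constant `S N` into a second `ε`.
  obtain ⟨s, hs, hsM⟩ := exists_le_dirichletSum_univ (S N / ε)
  refine ⟨s, hs, (dirichletSum_le_of_forall_sum_le hε.le hS0 hbound hs).trans ?_⟩
  have h5 : ENNReal.ofReal (S N) ≤ ENNReal.ofReal ε * dirichletSum Set.univ s := by
    rw [show S N = ε * (S N / ε) by field_simp, ENNReal.ofReal_mul hε.le]
    gcongr
  calc _ ≤ ENNReal.ofReal ε * dirichletSum Set.univ s +
        ENNReal.ofReal ε * dirichletSum Set.univ s := by gcongr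
    _ = _ := by rw [two_mul, ENNReal.ofReal_add hε.le hε.le]; ring

theorem exists_dirichletSum_Ioi_le {s : ℝ} (hs : 1 < s) {η : ℝ≥0∞} (hη : 0 < η) :
    ∃ K : ℕ, dirichletSum (Set.Ioi K) s ≤ η := by
  have hfin : ∑' n : ℕ+, ENNReal.ofReal ((n : ℝ) ^ (-s)) ≠ ∞ := by
    simpa [dirichletSum] using dirichletSum_ne_top Set.univ hs
  obtain ⟨t, ht⟩ := ((ENNReal.tendsto_tsum_compl_atTop_zero hfin).eventually_le_const hη).exists
  refine ⟨t.sup (fun n : ℕ+ => (n : ℕ)), le_trans ?_ ht⟩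
  refine le_trans ?_ (tsum_subtype {n : ℕ+ | n ∉ t} fun n : ℕ+ =>
    ENNReal.ofReal ((n : ℝ) ^ (-s))).ge
  refine ENNReal.tsum_le_tsum fun n => ?_
  by_cases hn : n ∈ t
  · rw [Set.indicator_of_notMem]
    · exact zero_le
    · simpa using Finset.le_sup (f := fun n : ℕ+ => (n : ℕ)) hn
  · rw [Set.indicator_of_mem (s := {n : ℕ+ | n ∉ t}) hn]
    exact Set.indicator_le_self' (fun _ _ => zero_le) _

/-! ### Periodic sets and truncations -/

/-- A periodic set has at least its natural density with respect to the weights `n ^ (-u)`, up to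
a factor tending to `1` as `u` tends to `1`. -/
theorem count_mul_dirichletSum_le (p : ℕ → Prop) [DecidablePred p] {L : ℕ} (hL : 0 < L)
    (hp : Function.Periodic p L) {u : ℝ} (hu : 0 ≤ u) :
    (Nat.count p L : ℝ≥0∞) * (ENNReal.ofReal ((L : ℝ) ^ (-u)) * dirichletSum Set.univ u) ≤
      dirichletSum {n | p n} u := by
  set T := (Finset.Ico 1 (1 + L)).filter p with hT
  have hcard : T.card = Nat.count p L := Nat.filter_Ico_card_eq_of_periodic 1 L p hp
  have hTpos : ∀ i ∈ T, 1 ≤ i ∧ i ≤ L ∧ p i := by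
    intro i hi
    simp only [hT, Finset.mem_filter, Finset.mem_Ico] at hi
    exact ⟨hi.1.1, by omega, hi.2⟩
  -- The `j`-th translate of a residue in `[1, L]` is at most `L * j`, hence has weight at least `L
  -- ^ (-u) * j ^ (-u)`.
  let f : T × ℕ+ → ℕ+ := fun x => ⟨x.1 + (x.2 - 1 : ℕ) * L, by have := hTpos _ x.1.2; omega⟩
  have hf : Function.Injective f := by
    rintro ⟨⟨i, hi⟩, j⟩ ⟨⟨i', hi'⟩, j'⟩ h
    have h1 : i + (j - 1 : ℕ) * L = i' + (j' - 1 : ℕ) * L := congrArg PNat.val h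
    obtain ⟨a1, a2, -⟩ := hTpos i hi
    obtain ⟨b1, b2, -⟩ := hTpos i' hi'
    have hdiv : ∀ i k : ℕ, 1 ≤ i → i ≤ L → (i - 1 + k * L) / L = k := fun i k h1 h2 => by
      rw [Nat.add_mul_div_right _ _ hL, Nat.div_eq_of_lt (by omega), zero_add]
    have hj : (j - 1 : ℕ) = j' - 1 := by
      rw [← hdiv i (j - 1) a1 a2, ← hdiv i' (j' - 1) b1 b2]
      congr 1
      omega
    have hii : i = i' := by rw [hj] at h1; omega
    have hjj : j = j' := PNat.coe_injective (by have := j.pos; have := j'.pos; omega)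
    subst hii hjj
    rfl
  calc _ = ∑' x : T × ℕ+, ENNReal.ofReal ((L : ℝ) ^ (-u)) * ENNReal.ofReal ((x.2 : ℝ) ^ (-u)) := by
        rw [ENNReal.tsum_prod', tsum_fintype]
        simp [dirichletSum, ENNReal.tsum_mul_left, hcard]
    _ ≤ ∑' x : T × ℕ+, Set.indicator {n | p n} (fun n => ENNReal.ofReal ((n : ℝ) ^ (-u)))
          (f x : ℕ) := by
        refine ENNReal.tsum_le_tsum fun ⟨⟨i, hi⟩, j⟩ => ?_
        obtain ⟨a1, a2, a3⟩ := hTpos i hi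
        have hmem : p (i + (j - 1 : ℕ) * L) := by
          have := hp.nat_mul (j - 1 : ℕ) i
          simp only [Nat.cast_id] at this
          rwa [this]
        rw [Set.indicator_of_mem (s := {n | p n}) (a := (f (⟨i, hi⟩, j) : ℕ)) hmem,
          ← ENNReal.ofReal_mul (by positivity), ← Real.mul_rpow (by positivity) (by positivity)]
        refine ENNReal.ofReal_le_ofReal (Real.rpow_le_rpow_of_nonpos ?_ ?_ (by linarith))
        · exact_mod_cast (f _).pos
        · have hle : i + (j - 1 : ℕ) * L ≤ L * j := by
            obtain ⟨k, hk⟩ : ∃ k, (j : ℕ) = k + 1 := ⟨j - 1, by have := j.pos; omega⟩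
            rw [hk, Nat.add_sub_cancel]
            nlinarith
          exact_mod_cast hle
    _ ≤ _ := ENNReal.tsum_comp_le_tsum_of_injective hf
        (fun n : ℕ+ => Set.indicator {n | p n} (fun n => ENNReal.ofReal ((n : ℝ) ^ (-u))) (n : ℕ))

theorem mem_of_mul_mem_freeNumbers {B : Set ℕ} {m n : ℕ} (h : m * n ∈ freeNumbers B) :
    m ∈ freeNumbers B :=
  fun b hb hbm => h b hb (hbm.mul_right n)

theorem periodic_mem_freeNumbers {B : Set ℕ} {L : ℕ} (hL : ∀ b ∈ B, b ∣ L) :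
    Function.Periodic (· ∈ freeNumbers B) L := by
  intro n
  refine propext (forall₂_congr fun b hb => not_congr ?_)
  exact (Nat.dvd_add_left (hL b hb))

/-- A number up to `K` has only divisors up to `K`, so truncating `B` does not affect whether it is
free. -/
theorem dirichletSum_freeNumbers_inter_Iic_le (B : Set ℕ) (K : ℕ) (s : ℝ) :
    dirichletSum (freeNumbers (B ∩ Set.Iic K)) s ≤
      dirichletSum (freeNumbers B) s + dirichletSum (Set.Ioi K) s := by
  rw [dirichletSum, dirichletSum, dirichletSum, ← ENNReal.tsum_add]
  refine ENNReal.tsum_le_tsum fun n => ?_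
  by_cases h : (n : ℕ) ∈ freeNumbers (B ∩ Set.Iic K)
  · rw [Set.indicator_of_mem h]
    by_cases hn : K < n
    · rw [Set.indicator_of_mem (s := Set.Ioi K) hn]
      exact le_add_self
    · rw [Set.indicator_of_mem (s := freeNumbers B)]
      · exact le_self_add
      · exact fun b hb hbn => h b ⟨hb, (Nat.le_of_dvd n.pos hbn).trans (not_lt.1 hn)⟩ hbn
  · rw [Set.indicator_of_notMem h]
    exact zero_le

open Classical in
/-- If the Dirichlet series of the free numbers of a set of divisors of `L` is small relative to
the full series at some `s > 1`, then the free numbers have small density. -/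
theorem count_freeNumbers_le {B : Set ℕ} {L : ℕ} (hL : 0 < L) (hBL : ∀ b ∈ B, b ∣ L) {ε s : ℝ}
    (hε : 0 ≤ ε) (hs : 1 < s)
    (h : dirichletSum (freeNumbers B) s ≤ ENNReal.ofReal ε * dirichletSum Set.univ s) :
    (Nat.count (· ∈ freeNumbers B) L : ℝ) ≤ ε * L := by
  have hu : ∀ u ∈ Set.Ioo 1 s, (Nat.count (· ∈ freeNumbers B) L : ℝ) * (L : ℝ) ^ (-u) ≤ ε := by
    rintro u ⟨hu1, hus⟩
    have h1 := count_mul_dirichletSum_le (· ∈ freeNumbers B) hL (periodic_mem_freeNumbers hBL)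
      (u := u) (by linarith)
    rw [Set.ofPred_mem_eq] at h1
    have h2 := dirichletSum_mul_le_of_dvd_closed (A := freeNumbers B)
      (fun _ _ => mem_of_mul_mem_freeNumbers) hus.le
    have hne : dirichletSum Set.univ u * dirichletSum Set.univ s ≠ 0 :=
      mul_ne_zero (one_pos.trans_le (one_le_dirichletSum_univ u)).ne'
        (one_pos.trans_le (one_le_dirichletSum_univ s)).ne'
    have htop : dirichletSum Set.univ u * dirichletSum Set.univ s ≠ ∞ :=
      ENNReal.mul_ne_top (dirichletSum_ne_top _ hu1) (dirichletSum_ne_top _ hs)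
    have h3 : ((Nat.count (· ∈ freeNumbers B) L : ℝ≥0∞) * ENNReal.ofReal ((L : ℝ) ^ (-u))) *
        (dirichletSum Set.univ u * dirichletSum Set.univ s) ≤
        ENNReal.ofReal ε * (dirichletSum Set.univ u * dirichletSum Set.univ s) :=
      calc _ = (Nat.count (· ∈ freeNumbers B) L : ℝ≥0∞) * (ENNReal.ofReal ((L : ℝ) ^ (-u)) *
            dirichletSum Set.univ u) * dirichletSum Set.univ s := by ring
        _ ≤ dirichletSum (freeNumbers B) u * dirichletSum Set.univ s := by gcongr
        _ ≤ dirichletSum (freeNumbers B) s * dirichletSum Set.univ u := h2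
        _ ≤ (ENNReal.ofReal ε * dirichletSum Set.univ s) * dirichletSum Set.univ u := by gcongr
        _ = _ := by ring
    rw [ENNReal.mul_le_mul_iff_left hne htop, ← ENNReal.ofReal_natCast,
      ← ENNReal.ofReal_mul (by positivity), ENNReal.ofReal_le_ofReal_iff hε] at h3
    exact h3
  have hL' : (0 : ℝ) < L := by exact_mod_cast hL
  have hlim : Tendsto (fun u : ℝ => (Nat.count (· ∈ freeNumbers B) L : ℝ) * (L : ℝ) ^ (-u))
      (𝓝[>] 1) (𝓝 ((Nat.count (· ∈ freeNumbers B) L : ℝ) * (L : ℝ) ^ (-1 : ℝ))) :=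
    ((((Real.continuous_const_rpow hL'.ne').comp continuous_neg).tendsto 1).mono_left
      nhdsWithin_le_nhds).const_mul _
  have hle := le_of_tendsto hlim (eventually_of_mem (Ioo_mem_nhdsGT hs) hu)
  rwa [Real.rpow_neg_one, ← div_eq_mul_inv, div_le_iff₀ hL'] at hle

open Classical in
/-- The free numbers of the finite truncations of a Behrend set have arbitrarily small density. -/
theorem IsBehrend.exists_count_le {B : Set ℕ} (hB : ∀ b ∈ B, 0 < b) (hBehrend : IsBehrend B)
    {ε : ℝ} (hε : 0 < ε) :
    ∃ K : ℕ, (Nat.count (· ∈ freeNumbers (B ∩ Set.Iic K)) K.factorial : ℝ) ≤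
      ε * K.factorial := by
  obtain ⟨s, hs, h⟩ := HasLogDensity.exists_dirichletSum_le hBehrend (ε := ε / 3) (by positivity)
  obtain ⟨K, hK⟩ := exists_dirichletSum_Ioi_le hs (η := ENNReal.ofReal (ε / 3)) (by simpa)
  refine ⟨K, count_freeNumbers_le K.factorial_pos
    (fun b hb => Nat.dvd_factorial (hB b hb.1) hb.2) hε.le hs ?_⟩
  calc _ ≤ _ := dirichletSum_freeNumbers_inter_Iic_le B K s
    _ ≤ ENNReal.ofReal (2 * (ε / 3)) * dirichletSum Set.univ s +
        ENNReal.ofReal (ε / 3) * dirichletSum Set.univ s := by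
      gcongr
      -- The full series is at least `1`, so the absolute tail bound is also a relative one.
      exact hK.trans (le_mul_of_one_le_right' (one_le_dirichletSum_univ s))
    _ = _ := by
      rw [← add_mul, ← ENNReal.ofReal_add (by positivity) (by positivity)]
      ring_nf

/-! ### Counting in windows -/

theorem card_filter_Ico_mul_of_periodic (p : ℕ → Prop) [DecidablePred p] {L : ℕ}
    (hp : Function.Periodic p L) (m k : ℕ) :
    ((Finset.Ico m (m + k * L)).filter p).card = k * Nat.count p L := by
  induction k with
  | zero => simp
  | succ k ih =>
    rw [add_mul, one_mul, add_mul, one_mul, ← add_assoc,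
      ← Finset.Ico_union_Ico_eq_Ico (Nat.le_add_right m (k * L)) (Nat.le_add_right _ L),
      Finset.filter_union, Finset.card_union_of_disjoint
        (Finset.disjoint_filter_filter (Finset.Ico_disjoint_Ico_consecutive _ _ _)), ih,
      Nat.filter_Ico_card_eq_of_periodic _ _ _ hp]

open Classical in
theorem maxWindowCount_le_of_isPrimitiveSet {B : Set ℕ} (hB : ∀ b ∈ B, 0 < b)
    (hprim : IsPrimitiveSet B) (K n : ℕ) :
    maxWindowCount B n ≤ K + 1 + (n / K.factorial + 1) *
      Nat.count (· ∈ freeNumbers (B ∩ Set.Iic K)) K.factorial := by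
  have : Nonempty {m : ℕ // 1 ≤ m} := ⟨⟨1, le_rfl⟩⟩
  refine ciSup_le fun ⟨m, hm⟩ => ?_
  have hper : Function.Periodic (· ∈ freeNumbers (B ∩ Set.Iic K)) K.factorial :=
    periodic_mem_freeNumbers fun b hb => Nat.dvd_factorial (hB b hb.1) hb.2
  have hsub : B ∩ Set.Icc m (m + n) ⊆ ((Finset.Iic K ∪
      (Finset.Ico m (m + (n / K.factorial + 1) * K.factorial)).filter
        (· ∈ freeNumbers (B ∩ Set.Iic K)) : Finset ℕ) : Set ℕ) := by
    rintro b ⟨hb, hmb, hbn⟩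
    rw [Finset.mem_coe, Finset.mem_union, Finset.mem_Iic, Finset.mem_filter, Finset.mem_Ico]
    refine or_iff_not_imp_left.2 fun hbK => ⟨⟨hmb, ?_⟩, fun c hc hcb => ?_⟩
    · have := Nat.lt_div_mul_add (a := n) K.factorial_pos
      linarith
    -- A divisor `c ≤ K` of `b` in `B` would equal `b` by primitivity, but `b > K`.
    · exact hbK (hprim c hc.1 b hb hcb ▸ hc.2)
  refine (Set.ncard_le_ncard hsub (Finset.finite_toSet _)).trans ?_
  rw [Set.ncard_coe_finset]
  refine (Finset.card_union_le _ _).trans ?_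
  rw [card_filter_Ico_mul_of_periodic _ hper, Nat.card_Iic]

theorem mainTheorem11 (B : Set ℕ) (hB : ∀ b ∈ B, 2 ≤ b) (hprim : IsPrimitiveSet B)
    (hBehrend : IsBehrend B) : upperBanachDensity B = 0 := by
  classical
  have hB0 : ∀ b ∈ B, 0 < b := fun b hb => two_pos.trans_le (hB b hb)
  refine Tendsto.limsup_eq (tendsto_order.2 ⟨fun a ha => Eventually.of_forall fun n =>
    ha.trans_le (by positivity), fun ε hε => ?_⟩)
  obtain ⟨K, hK⟩ := hBehrend.exists_count_le hB0 (half_pos hε)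
  set r := Nat.count (· ∈ freeNumbers (B ∩ Set.Iic K)) K.factorial with hr
  -- Only the quotient term of the window bound grows with `n`; the remainder `K + 1 + r` is
  -- constant.
  have hlim : Tendsto (fun n : ℕ => ((K + 1 + r : ℕ) : ℝ) / n) atTop (𝓝 0) :=
    tendsto_const_div_atTop_nhds_zero_nat _
  filter_upwards [hlim.eventually_lt_const (half_pos hε), eventually_gt_atTop 0] with n hn hn0
  have hn0' : (0 : ℝ) < n := by exact_mod_cast hn0
  have hfac : (0 : ℝ) < K.factorial := by exact_mod_cast K.factorial_pos
  have hcount : (maxWindowCount B n : ℝ) ≤ K + 1 + ((n / K.factorial : ℕ) + 1) * r := by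
    exact_mod_cast maxWindowCount_le_of_isPrimitiveSet hB0 hprim K n
  have hquot : ((n / K.factorial : ℕ) : ℝ) * r ≤ ε / 2 * n :=
    calc ((n / K.factorial : ℕ) : ℝ) * r ≤ n / K.factorial * (ε / 2 * K.factorial) := by
          gcongr
          exact Nat.cast_div_le
      _ = ε / 2 * n := by field_simp
  rw [div_lt_iff₀ hn0'] at hn ⊢
  push_cast at hn
  nlinarith
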